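/- Let $\Gamma$ be a finite connected simple graph without triangles. For a vertex $v$ write $\mathrm{lk}(v)$ for its set of neighbours; $v$ is a satellite of a vertex $w\neq v$ if $\mathrm{lk}(v)\subseteq \mathrm{lk}(w)$. Let $W_\Gamma$ be the right-angled Coxeter group with presentation graph $\Gamma$, and let $\Sigma_\Gamma$ be its Davis complex: the cube complex whose 1-skeleton is the Cayley graph of $W_\Gamma$ with respect to the vertices of $\Gamma$ (each edge colored by the corresponding generator), and whose cubes are spanned by the cosets $xW_T$ with $x\in W_\Gamma$ and $T$ a clique of $\Gamma$. It is given the combinatorial metric, i.e. the path metric of the 1-skeleton on the vertex set $W_\Gamma$. For a set $A$ of vertices of $\Gamma$, let $\Sigma_A\subseteq\Sigma_\Gamma$ be the subcomplex with vertex set the special subgroup $W_A=\langle A\rangle$, whose cubes are spanned by the cosets $xW_T$ with $x\in W_A$ and $T\subseteq A$ a clique. Let $v$ be a vertex of $\Gamma$ that is a satellite of at least two other vertices, and let $\Gamma'$ be the graph obtained from $\Gamma$ by adding one new vertex $v'$ joined by an edge to exactly the vertices of $\mathrm{lk}(v)$. Then there is a quasiisometry $\varphi\colon\Sigma_\Gamma\to\Sigma_{\Gamma'}$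 (in particular $W_\Gamma$ and $W_{\Gamma'}$ are quasiisometric) such that for every $g\in W_\Gamma$ there is $g'\in W_{\Gamma'}$ for which $\varphi$ restricts to a color-preserving isomorphism of cube complexes from $g\Sigma_{\Gamma\setminus\{v\}}\subseteq\Sigma_\Gamma$ onto $g'\Sigma_{\Gamma\setminus\{v\}}\subseteq\Sigma_{\Gamma'}$. -/

import Mathlib

open scoped Pointwise

section Graphs

variable {V : Type*}

/-- `v` is a satellite of `w`: `v ≠ w` and the link of `v` is contained in the link of `w`. -/
def IsSatellite (Γ : SimpleGraph V) (v w : V) : Prop :=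
  v ≠ w ∧ Γ.neighborSet v ⊆ Γ.neighborSet w

/-- `v` is clonable: it is a satellite of at least two other vertices. -/
def IsClonable (Γ : SimpleGraph V) (v : V) : Prop :=
  ∃ w₁ w₂ : V, w₁ ≠ w₂ ∧ IsSatellite Γ v w₁ ∧ IsSatellite Γ v w₂

/-- The graph obtained from `Γ` by coning off the vertex set `L`: a new vertex `none` is added and
joined by an edge to exactly the vertices in `L`. The old vertices are the `some x`. -/
def coneOff (Γ : SimpleGraph V) (L : Set V) : SimpleGraph (Option V) where
  Adj
    | some x, some y => Γ.Adj x y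
    | some x, none => x ∈ L
    | none, some y => y ∈ L
    | none, none => False
  symm := ⟨by
    rintro (_ | x) (_ | y) h
    · exact h
    · exact h
    · exact h
    · exact Γ.adj_symm h⟩
  loopless := ⟨by
    rintro (_ | x) h
    · exact h
    · exact Γ.loopless.irrefl x h⟩

/-- The graph obtained from `Γ` by cloning `v`: a twin `none` of `v` is added. -/
def cloneGraph (Γ : SimpleGraph V) (v : V) : SimpleGraph (Option V) :=
  coneOff Γ (Γ.neighborSet v)

end Graphs

section RightAngledCoxeterGroups

variable {V : Type*}

open scoped Classical in
/-- The Coxeter matrix of the right-angled Coxeter group with presentation graph `Γ`: adjacent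
generators have product of order `2`, and there is no relation (entry `0`) between distinct
non-adjacent generators. -/
noncomputable def racgMatrix (Γ : SimpleGraph V) : CoxeterMatrix V where
  M := Matrix.of fun i j => if i = j then 1 else if Γ.Adj i j then 2 else 0
  isSymm := by
    ext i j
    simp only [Matrix.transpose_apply, Matrix.of_apply, eq_comm (a := j), Γ.adj_comm j]
  diagonal i := by simp
  off_diagonal i j h := by
    simp only [Matrix.of_apply, if_neg h]
    split <;> simp

/-- The right-angled Coxeter group `W_Γ` with presentation graph `Γ`. -/
noncomputable abbrev RACG (Γ : SimpleGraph V) : Type _ := (racgMatrix Γ).Group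

/-- The generator of `W_Γ` given by a vertex of `Γ`. -/
noncomputable def racgGen (Γ : SimpleGraph V) (s : V) : RACG Γ := (racgMatrix Γ).simple s

/-- The special subgroup `W_A < W_Γ` generated by a set `A` of vertices. -/
noncomputable def specialSubgroup (Γ : SimpleGraph V) (A : Set V) : Subgroup (RACG Γ) :=
  Subgroup.closure (racgGen Γ '' A)

/-- The 1-skeleton of the Davis complex `Σ_Γ`: the Cayley graph of `W_Γ` with respect to the
generators given by the vertices of `Γ`. Its path metric is the combinatorial metric of `Σ_Γ`, and
is the word metric of `W_Γ`. -/
noncomputable def davisSkeleton (Γ : SimpleGraph V) : SimpleGraph (RACG Γ) :=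
  SimpleGraph.mulCayley (Set.range (racgGen Γ))

/-- `x` and `y` are the two ends of an edge of color `s` of the Davis complex. -/
def IsDavisEdge (Γ : SimpleGraph V) (s : V) (x y : RACG Γ) : Prop :=
  y = x * racgGen Γ s

/-- The vertex set of the standard subcomplex `g Σ_A` of the Davis complex `Σ_Γ`, which is the
translate by `g` of the subcomplex `Σ_A`. -/
def standardVertices (Γ : SimpleGraph V) (A : Set V) (g : RACG Γ) : Set (RACG Γ) :=
  g • (specialSubgroup Γ A : Set (RACG Γ))

/-- The cubes of the standard subcomplex `g Σ_A`, given by their vertex sets: the cosets `x W_T`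
with `x` a vertex of `g Σ_A` and `T ⊆ A` a clique of `Γ`. (For `A = Set.univ` these are all cubes
of the Davis complex `Σ_Γ`.) -/
def standardCubes (Γ : SimpleGraph V) (A : Set V) (g : RACG Γ) : Set (Set (RACG Γ)) :=
  {c | ∃ x ∈ standardVertices Γ A g, ∃ T : Set V, T ⊆ A ∧ Γ.IsClique T ∧
    c = x • (specialSubgroup Γ T : Set (RACG Γ))}

/-- The map `φ` restricts to a color-preserving isomorphism of cube complexes from the standard
subcomplex `g Σ_A` of `Σ_Γ` onto the standard subcomplex `g' Σ_{κ(A)}` of `Σ_{Γ'}`. Here `κ`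
identifies the colors of the source with colors of the target. -/
structure IsColorPreservingIso {V' : Type*} {Γ : SimpleGraph V} {Γ' : SimpleGraph V'}
    (κ : V → V') (A : Set V) (φ : RACG Γ → RACG Γ') (g : RACG Γ) (g' : RACG Γ') : Prop where
  bijOn : Set.BijOn φ (standardVertices Γ A g) (standardVertices Γ' (κ '' A) g')
  edge_iff : ∀ x ∈ standardVertices Γ A g, ∀ y ∈ standardVertices Γ A g, ∀ s ∈ A,
    IsDavisEdge Γ s x y ↔ IsDavisEdge Γ' (κ s) (φ x) (φ y)
  cube_iff : ∀ c ⊆ standardVertices Γ A g,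
    c ∈ standardCubes Γ A g ↔ φ '' c ∈ standardCubes Γ' (κ '' A) g'

end RightAngledCoxeterGroups

/-- `φ` is a quasiisometry between the vertex sets of two graphs with their path metrics: an
`(L, A)`-coarse biLipschitz map with `A`-coarsely dense image, for some `L ≥ 1` and `A ≥ 0`.
(Meant for connected graphs, such as `davisSkeleton Γ`.) -/
def IsQuasiIsometry {X Y : Type*} (G : SimpleGraph X) (H : SimpleGraph Y) (φ : X → Y) : Prop :=
  ∃ L A : ℝ, 1 ≤ L ∧ 0 ≤ A ∧
    (∀ x x' : X, (1 / L) * (G.dist x x' : ℝ) - A ≤ (H.dist (φ x) (φ x') : ℝ) ∧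
      (H.dist (φ x) (φ x') : ℝ) ≤ L * (G.dist x x' : ℝ) + A) ∧
    ∀ y : Y, ∃ x : X, (H.dist (φ x) y : ℝ) ≤ A

/-!
Let `w₁, w₂` be two vertices of which `v` is a satellite, `Γ'` the graph obtained by cloning `v`
into `v` and `v'`, and `a, b` the generators of `w₁, w₂`. As `Γ` is connected and has no triangles,
`w₁, w₂, v, v'` are pairwise non-adjacent, and all of them are joined to the link of `v`. The map
`φ` is a bijection `W_Γ → W_Γ'` with `φ (g s) = φ g s` for every generator `s ≠ v`; such a map sends
`g W_A` to `φ g W_A` by a translation, which gives the colour-preserving isomorphisms. It is an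
orbit map: one constructs on the set `W_Γ'` an involution `V` that commutes with right multiplication
by the link of `v`, and lets `v` act by `V` and the other generators by right multiplication.

The involution `V` has to be a bounded rewiring of the two involutions `v` and `v'`, and this cannot
be done equivariantly for a subgroup of finite index, for reasons of Euler characteristic. Instead
the group is mapped to a set of labels, here `ℕ`, on which `a, b, v, v'` act by explicit involutions
`flipBit, swapMid, tailMove, twinMove` and all other generators act trivially. On labels, `n ↦ 4 n`
and a bijection `avoidFour` from `ℕ` to the numbers not divisible by `4` are both given by words of
bounded length in `flipBit, swapMid, tailMove` (`reach_four_mul`, `reach_avoidFour`), that is, these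
three involutions generate a paradoxical decomposition of `ℕ` into two copies of itself. Over the
labels not divisible by `4`, `V` is the conjugate of `v'` by the lift of `avoidFour`, and over the
multiples of `4` it is the conjugate of `v` by the lift of `n ↦ 4 n` (`IsFold`); the words of the
second lift use, in place of `v`, the part of `V` already defined.

This construction can be undone (`exists_isFold`, `exists_isFold_of_folded`): from `a, b, V` one
recovers first `v` and then `v'`. Both directions move points by a bounded amount
(`IsFold.dist_folded_le`, `IsFold.dist_unfolded_le`) and are natural for maps of labelled sets
(`IsFold.map_folded`, `IsFold.map_unfolded`). Naturality for right multiplications shows that the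
new involutions commute with the link of `v`, so that each group acts on the other one; naturality
for the two orbit maps `W_Γ → W_Γ'` and `W_Γ' → W_Γ` shows that they are mutually inverse. Both are
Lipschitz, hence quasiisometries (`exists_lipschitz_bijection`).
-/

/-! ### The set of labels -/

/-- The involution of `ℕ` that flips the binary digit of weight `1`. -/
def flipBit (n : ℕ) : ℕ := if n % 2 = 0 then n + 1 else n - 1

/-- The involution of `ℕ` that swaps `4u + 1` and `4u + 2`. -/
def swapMid (n : ℕ) : ℕ := if n % 4 = 1 then n + 1 else if n % 4 = 2 then n - 1 else n

/-- The involution of `ℕ` that swaps `4u + 1` and `4u + 3`. -/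
def swapOdd (n : ℕ) : ℕ := if n % 4 = 1 then n + 2 else if n % 4 = 3 then n - 2 else n

/-- The involution of `ℕ` that swaps `2u` and `4u + 1`. -/
def growBit (n : ℕ) : ℕ := if n % 2 = 0 then 2 * n + 1 else if n % 4 = 1 then n / 2 else n

/-- The involution of `ℕ` that fixes the multiples of `4` and acts on the part `u` of `4u + i` by
`flipBit`, `swapOdd` or `growBit` when `i` is `1`, `2` or `3`. -/
def tailMove (n : ℕ) : ℕ :=
  if n % 4 = 0 then n else if n % 4 = 1 then 4 * flipBit (n / 4) + 1
  else if n % 4 = 2 then 4 * swapOdd (n / 4) + 2 else 4 * growBit (n / 4) + 3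

/-- The action of the generator `v` of the original graph on labels: on the multiples of `4` it is
`tailMove`, transported along `n ↦ 4 * n`. -/
def foldedMove (n : ℕ) : ℕ := if n % 4 = 0 then 4 * tailMove (n / 4) else tailMove n

/-- A bijection from `ℕ` to the numbers that are not multiples of `4`. -/
def avoidFour (n : ℕ) : ℕ := if n % 2 = 0 then 2 * n + 2 else n

/-- The inverse of `avoidFour` on the numbers that are not multiples of `4`. -/
def avoidFourInv (n : ℕ) : ℕ := if n % 2 = 0 then n / 2 - 1 else n

/-- The action of the twin of `v` on labels: `tailMove`, transported along `avoidFour`. (After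
cloning, `v` itself acts on labels by `tailMove`.) -/
def twinMove (n : ℕ) : ℕ := avoidFourInv (tailMove (avoidFour n))

/-- The three basic involutions of the set of labels. -/
def basicMove : Fin 3 → ℕ → ℕ := ![flipBit, swapMid, tailMove]

theorem flipBit_flipBit (n : ℕ) : flipBit (flipBit n) = n := by unfold flipBit; grind

theorem swapMid_swapMid (n : ℕ) : swapMid (swapMid n) = n := by unfold swapMid; grind

theorem swapOdd_swapOdd (n : ℕ) : swapOdd (swapOdd n) = n := by unfold swapOdd; grind

theorem growBit_growBit (n : ℕ) : growBit (growBit n) = n := by unfold growBit; grind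

theorem tailMove_mod (n : ℕ) : tailMove n % 4 = n % 4 := by unfold tailMove; grind

theorem tailMove_four_mul_add_one (u : ℕ) : tailMove (4 * u + 1) = 4 * flipBit u + 1 := by
  unfold tailMove
  rw [if_neg (by omega), if_pos (by omega), show (4 * u + 1) / 4 = u by omega]

theorem tailMove_four_mul_add_two (u : ℕ) : tailMove (4 * u + 2) = 4 * swapOdd u + 2 := by
  unfold tailMove
  rw [if_neg (by omega), if_neg (by omega), if_pos (by omega), show (4 * u + 2) / 4 = u by omega]

theorem tailMove_four_mul_add_three (u : ℕ) : tailMove (4 * u + 3) = 4 * growBit u + 3 := by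
  unfold tailMove
  rw [if_neg (by omega), if_neg (by omega), if_neg (by omega), show (4 * u + 3) / 4 = u by omega]

theorem tailMove_tailMove (n : ℕ) : tailMove (tailMove n) = n := by
  obtain ⟨u, hu | hu | hu | hu⟩ : ∃ u, n = 4 * u ∨ n = 4 * u + 1 ∨ n = 4 * u + 2 ∨ n = 4 * u + 3 :=
    ⟨n / 4, by omega⟩
  · simp [tailMove, hu]
  · rw [hu, tailMove_four_mul_add_one, tailMove_four_mul_add_one, flipBit_flipBit]
  · rw [hu, tailMove_four_mul_add_two, tailMove_four_mul_add_two, swapOdd_swapOdd]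
  · rw [hu, tailMove_four_mul_add_three, tailMove_four_mul_add_three, growBit_growBit]

theorem foldedMove_of_mod_eq_zero {n : ℕ} (h : n % 4 = 0) : foldedMove n = 4 * tailMove (n / 4) :=
  if_pos h

theorem foldedMove_of_mod_ne_zero {n : ℕ} (h : n % 4 ≠ 0) : foldedMove n = tailMove n :=
  if_neg h

theorem foldedMove_foldedMove (n : ℕ) : foldedMove (foldedMove n) = n := by
  by_cases h : n % 4 = 0
  · rw [foldedMove_of_mod_eq_zero h, foldedMove_of_mod_eq_zero (by omega),
      Nat.mul_div_cancel_left _ (by omega), tailMove_tailMove]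
    omega
  · rw [foldedMove_of_mod_ne_zero h, foldedMove_of_mod_ne_zero (by rwa [tailMove_mod]),
      tailMove_tailMove]

theorem avoidFour_mod_ne_zero (n : ℕ) : avoidFour n % 4 ≠ 0 := by unfold avoidFour; grind

theorem avoidFourInv_avoidFour (n : ℕ) : avoidFourInv (avoidFour n) = n := by
  unfold avoidFour avoidFourInv; grind

theorem avoidFour_avoidFourInv {n : ℕ} (h : n % 4 ≠ 0) : avoidFour (avoidFourInv n) = n := by
  unfold avoidFour avoidFourInv; grind

theorem avoidFour_twinMove (n : ℕ) : avoidFour (twinMove n) = tailMove (avoidFour n) :=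
  avoidFour_avoidFourInv (by rw [tailMove_mod]; exact avoidFour_mod_ne_zero n)

theorem twinMove_twinMove (n : ℕ) : twinMove (twinMove n) = n := by
  rw [twinMove, avoidFour_twinMove, tailMove_tailMove, avoidFourInv_avoidFour]

theorem basicMove_basicMove (l : Fin 3) (n : ℕ) : basicMove l (basicMove l n) = n := by
  fin_cases l
  · exact flipBit_flipBit n
  · exact swapMid_swapMid n
  · exact tailMove_tailMove n

/-! ### Words of involutions -/

/-- The action of a word on a point, the letters being applied from left to right. -/
def actWord {Y : Type*} (f : Fin 3 → Y → Y) (w : List (Fin 3)) (y : Y) : Y :=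
  w.foldl (fun z l => f l z) y

section Words

variable {Y Z : Type*} {f : Fin 3 → Y → Y}

theorem actWord_append (w w' : List (Fin 3)) (y : Y) :
    actWord f (w ++ w') y = actWord f w' (actWord f w y) := by
  simp [actWord]

theorem actWord_cons (l : Fin 3) (w : List (Fin 3)) (y : Y) :
    actWord f (l :: w) y = actWord f w (f l y) := rfl

theorem actWord_reverse_actWord (hf : ∀ l y, f l (f l y) = y) (w : List (Fin 3)) (y : Y) :
    actWord f w.reverse (actWord f w y) = y := by
  induction w generalizing y with
  | nil => rfl
  | cons l w ih =>
    rw [List.reverse_cons, actWord_append, actWord_cons l w y, ih]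
    exact hf l y

theorem actWord_actWord_reverse (hf : ∀ l y, f l (f l y) = y) (w : List (Fin 3)) (y : Y) :
    actWord f w (actWord f w.reverse y) = y := by
  simpa using actWord_reverse_actWord hf w.reverse y

theorem map_actWord {g : Fin 3 → Z → Z} {F : Y → Z} (h : ∀ l y, F (f l y) = g l (F y))
    (w : List (Fin 3)) (y : Y) : F (actWord f w y) = actWord g w (F y) := by
  induction w generalizing y with
  | nil => rfl
  | cons l w ih => rw [actWord_cons, actWord_cons, ih, h]

theorem dist_actWord_le {d : Y → Y → ℕ} (hd : ∀ y, d y y = 0)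
    (htri : ∀ x y z, d x z ≤ d x y + d y z) {K : ℕ} (h : ∀ l y, d y (f l y) ≤ K)
    (w : List (Fin 3)) (y : Y) : d y (actWord f w y) ≤ w.length * K := by
  induction w generalizing y with
  | nil => simp [actWord, hd]
  | cons l w ih =>
    rw [actWord_cons, List.length_cons, add_mul, one_mul]
    have h1 := htri y (f l y) (actWord f w (f l y))
    have h2 := h l y
    have h3 := ih (f l y)
    omega

end Words

/-- `m` is reached from `n` by at most `k` of the three basic involutions of the labels. -/
def Reach (k n m : ℕ) : Prop := ∃ w : List (Fin 3), w.length ≤ k ∧ actWord basicMove w n = m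

theorem Reach.trans {k k' n m p : ℕ} (h : Reach k n m) (h' : Reach k' m p) :
    Reach (k + k') n p := by
  obtain ⟨w, hw, rfl⟩ := h
  obtain ⟨w', hw', rfl⟩ := h'
  exact ⟨w ++ w', by simp; omega, actWord_append ..⟩

theorem Reach.mono {k k' n m : ℕ} (h : Reach k n m) (hk : k ≤ k') : Reach k' n m := by
  obtain ⟨w, hw, rfl⟩ := h
  exact ⟨w, hw.trans hk, rfl⟩

theorem reach_block (u : ℕ) {i j : ℕ} (hi : i < 4) (hj : j < 4) :
    Reach 3 (4 * u + i) (4 * u + j) := by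
  have h0 : flipBit (4 * u) = 4 * u + 1 := by unfold flipBit; grind
  have h1 : flipBit (4 * u + 1) = 4 * u := by unfold flipBit; grind
  have h2 : flipBit (4 * u + 2) = 4 * u + 3 := by unfold flipBit; grind
  have h3 : flipBit (4 * u + 3) = 4 * u + 2 := by unfold flipBit; grind
  have h4 : swapMid (4 * u + 1) = 4 * u + 2 := by unfold swapMid; grind
  have h5 : swapMid (4 * u + 2) = 4 * u + 1 := by unfold swapMid; grind
  -- The four labels of a block form the path `0 - 1 - 2 - 3`.
  refine ⟨if i = j then [] else if i = 0 then [0, 1, 0].take j else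
    if i = 3 then [0, 1, 0].take (3 - j) else if i = 1 then
      (if j = 0 then [0] else [1, 0].take (j - 1)) else
      (if j = 3 then [0] else [1, 0].take (2 - j)), ?_, ?_⟩
  · interval_cases i <;> interval_cases j <;> simp
  · interval_cases i <;> interval_cases j <;>
      simp [actWord, basicMove, h0, h1, h2, h3, h4, h5]

theorem reach_tailMove (n : ℕ) : Reach 1 n (tailMove n) := ⟨[2], by simp, rfl⟩

theorem reach_tail {u u' i : ℕ} (hi : i < 4) (h : tailMove (4 * u + i) = 4 * u' + i)
    {j j' : ℕ} (hj : j < 4) (hj' : j' < 4) : Reach 7 (4 * u + j) (4 * u' + j') :=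
  ((reach_block u hj hi).trans (h ▸ reach_tailMove (4 * u + i))).trans (reach_block u' hi hj')

/-- Up to basic involutions, a binary digit can be inserted below the part `u` of `4u + i`. -/
theorem reach_insert (u : ℕ) {c i j : ℕ} (hc : c < 2) (hi : i < 4) (hj : j < 4) :
    Reach 28 (4 * u + i) (4 * (2 * u + c) + j) := by
  have flip (u : ℕ) {i j : ℕ} (hi : i < 4) (hj : j < 4) :
      Reach 7 (4 * u + i) (4 * flipBit u + j) :=
    reach_tail (by omega) (tailMove_four_mul_add_one u) hi hj
  have swap (u : ℕ) {i j : ℕ} (hi : i < 4) (hj : j < 4) :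
      Reach 7 (4 * u + i) (4 * swapOdd u + j) :=
    reach_tail (by omega) (tailMove_four_mul_add_two u) hi hj
  have grow (u : ℕ) {i j : ℕ} (hi : i < 4) (hj : j < 4) :
      Reach 7 (4 * u + i) (4 * growBit u + j) :=
    reach_tail (by omega) (tailMove_four_mul_add_three u) hi hj
  have one : ∀ {j : ℕ}, j < 4 → Reach 21 (4 * u + i) (4 * (2 * u + 1) + j) := by
    intro j hj
    rcases Nat.mod_two_eq_zero_or_one u with hu | hu
    · have h : growBit u = 2 * u + 1 := by unfold growBit; grind
      exact (h ▸ grow u hi hj : Reach 7 _ _).mono (by omega)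
    · have h : swapOdd (growBit (flipBit u)) = 2 * u + 1 := by
        unfold flipBit growBit swapOdd; grind
      exact h ▸ ((flip u hi hi).trans (grow _ hi hi)).trans (swap _ hi hj)
  rcases (by omega : c = 0 ∨ c = 1) with rfl | rfl
  · have h : flipBit (2 * u + 1) = 2 * u + 0 := by unfold flipBit; grind
    exact h ▸ (one hi).trans (flip _ hi hj)
  · exact (one hj).mono (by omega)

theorem reach_four_mul (n : ℕ) : Reach 56 n (4 * n) := by
  have h1 := reach_insert (n / 4) (c := n / 2 % 2) (i := n % 4) (j := 0)
    (by omega) (by omega) (by omega)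
  have h2 := reach_insert (2 * (n / 4) + n / 2 % 2) (c := n % 2) (i := 0) (j := 0)
    (by omega) (by omega) (by omega)
  convert h1.trans h2 using 1 <;> omega

theorem reach_avoidFour (n : ℕ) : Reach 56 n (avoidFour n) := by
  unfold avoidFour
  split
  · have h := reach_insert (n / 4) (c := n / 2 % 2) (i := n % 4) (j := 2)
      (by omega) (by omega) (by omega)
    refine Reach.mono (k := 28) ?_ (by omega)
    convert h using 1 <;> omega
  · exact ⟨[], by simp, rfl⟩

/-- A word in the basic involutions that leads from `n` to `4 * n`. -/
noncomputable def wordFour (n : ℕ) : List (Fin 3) := (reach_four_mul n).choose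

theorem length_wordFour (n : ℕ) : (wordFour n).length ≤ 56 := (reach_four_mul n).choose_spec.1

theorem actWord_wordFour (n : ℕ) : actWord basicMove (wordFour n) n = 4 * n :=
  (reach_four_mul n).choose_spec.2

/-- A word in the basic involutions that leads from `n` to `avoidFour n`. -/
noncomputable def wordAvoid (n : ℕ) : List (Fin 3) := (reach_avoidFour n).choose

theorem length_wordAvoid (n : ℕ) : (wordAvoid n).length ≤ 56 := (reach_avoidFour n).choose_spec.1

theorem actWord_wordAvoid (n : ℕ) : actWord basicMove (wordAvoid n) n = avoidFour n :=
  (reach_avoidFour n).choose_spec.2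

/-! ### Folding two involutions into one -/

section Fold

variable {Y Z : Type*}

/-- `f` is an involution of the labelled set `Y` that induces the map `m` on labels. -/
structure IsLabelled (π : Y → ℕ) (f : Y → Y) (m : ℕ → ℕ) : Prop where
  invol : ∀ y, f (f y) = y
  label : ∀ y, π (f y) = m (π y)

theorem IsLabelled.triple {π : Y → ℕ} {a b e : Y → Y} (ha : IsLabelled π a flipBit)
    (hb : IsLabelled π b swapMid) (he : IsLabelled π e tailMove) (l : Fin 3) :
    IsLabelled π (![a, b, e] l) (basicMove l) := by
  fin_cases l
  exacts [ha, hb, he]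

/-- The lift to a labelled set of the map of labels that is described by the words `W`: every point
is moved along the word of its label. -/
def liftMap (π : Y → ℕ) (W : ℕ → List (Fin 3)) (f : Fin 3 → Y → Y) (y : Y) : Y :=
  actWord f (W (π y)) y

/-- The inverse of `liftMap π W f`, given the inverse `m'` of the underlying map of labels. -/
def liftInv (π : Y → ℕ) (W : ℕ → List (Fin 3)) (m' : ℕ → ℕ) (f : Fin 3 → Y → Y) (y : Y) : Y :=
  actWord f (W (m' (π y))).reverse y

section Lift

variable {π : Y → ℕ} {f : Fin 3 → Y → Y} {W : ℕ → List (Fin 3)} {m m' : ℕ → ℕ}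

theorem label_liftMap (hf : ∀ l, IsLabelled π (f l) (basicMove l))
    (hW : ∀ n, actWord basicMove (W n) n = m n) (y : Y) : π (liftMap π W f y) = m (π y) := by
  rw [liftMap, map_actWord fun l => (hf l).label, hW]

theorem label_liftInv (hf : ∀ l, IsLabelled π (f l) (basicMove l))
    (hW : ∀ n, actWord basicMove (W n) n = m n) {y : Y} (hy : m (m' (π y)) = π y) :
    π (liftInv π W m' f y) = m' (π y) := by
  rw [liftInv, map_actWord fun l => (hf l).label]
  have h := actWord_reverse_actWord basicMove_basicMove (W (m' (π y))) (m' (π y))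
  rwa [hW, hy] at h

theorem liftInv_liftMap (hf : ∀ l, IsLabelled π (f l) (basicMove l))
    (hW : ∀ n, actWord basicMove (W n) n = m n) (hm : ∀ n, m' (m n) = n) (y : Y) :
    liftInv π W m' f (liftMap π W f y) = y := by
  rw [liftInv, label_liftMap hf hW, hm, liftMap, actWord_reverse_actWord fun l => (hf l).invol]

theorem liftMap_liftInv (hf : ∀ l, IsLabelled π (f l) (basicMove l))
    (hW : ∀ n, actWord basicMove (W n) n = m n) {y : Y} (hy : m (m' (π y)) = π y) :
    liftMap π W f (liftInv π W m' f y) = y := by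
  rw [liftMap, label_liftInv hf hW hy, liftInv, actWord_actWord_reverse fun l => (hf l).invol]

theorem dist_liftMap_le {d : Y → Y → ℕ} (hd : ∀ y, d y y = 0)
    (htri : ∀ x y z, d x z ≤ d x y + d y z) {K N : ℕ} (h : ∀ l y, d y (f l y) ≤ K)
    (hN : ∀ n, (W n).length ≤ N) (y : Y) : d y (liftMap π W f y) ≤ N * K :=
  (dist_actWord_le hd htri h _ y).trans (Nat.mul_le_mul_right K (hN _))

theorem map_liftMap {ρ : Z → ℕ} {g : Fin 3 → Z → Z} {F : Y → Z} (hF : ∀ y, ρ (F y) = π y)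
    (h : ∀ l y, F (f l y) = g l (F y)) (y : Y) : F (liftMap π W f y) = liftMap ρ W g (F y) := by
  rw [liftMap, map_actWord h, liftMap, hF]

end Lift

theorem forall_triple {a b e : Y → Y} {P : (Y → Y) → Prop} (ha : P a) (hb : P b) (he : P e)
    (l : Fin 3) : P (![a, b, e] l) := by
  fin_cases l
  exacts [ha, hb, he]

/-- The part of an involution `V` that lives over the labels not divisible by `4`, extended by the
identity. -/
def outerPart (π : Y → ℕ) (V : Y → Y) (y : Y) : Y := if π y % 4 = 0 then y else V y

/-- The involution `V` of a labelled set is obtained by folding the two involutions `v` and `v'`: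
over the labels not divisible by `4` it is `v'`, transported along a lift of `avoidFour` by words in
`a`, `b`, `v`, and over the multiples of `4` it is `v`, transported along a lift of `n ↦ 4 * n` by
words in `a`, `b` and the part of `V` already defined. -/
structure IsFold (π : Y → ℕ) (a b v v' V : Y → Y) : Prop where
  four : ∀ y, V (liftMap π wordFour ![a, b, outerPart π V] y) =
    liftMap π wordFour ![a, b, outerPart π V] (v y)
  avoid : ∀ y, V (liftMap π wordAvoid ![a, b, v] y) = liftMap π wordAvoid ![a, b, v] (v' y)

variable {π : Y → ℕ} {a b v v' V : Y → Y}

theorem outerPart_isLabelled (hV : IsLabelled π V foldedMove) :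
    IsLabelled π (outerPart π V) tailMove where
  invol y := by
    unfold outerPart
    by_cases h : π y % 4 = 0
    · simp [h]
    · rw [if_neg h, if_neg, hV.invol]
      rwa [hV.label, foldedMove_of_mod_ne_zero h, tailMove_mod]
  label y := by
    unfold outerPart
    by_cases h : π y % 4 = 0
    · simp [h, tailMove]
    · rw [if_neg h, hV.label, foldedMove_of_mod_ne_zero h]

theorem four_mul_div_label {y : Y} (h : π y % 4 = 0) : 4 * (π y / 4) = π y := by omega

/-- Two involutions over `tailMove` and `twinMove` can be folded into one over `foldedMove`. -/
theorem exists_isFold (ha : IsLabelled π a flipBit) (hb : IsLabelled π b swapMid)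
    (hv : IsLabelled π v tailMove) (hv' : IsLabelled π v' twinMove) :
    ∃ V, IsLabelled π V foldedMove ∧ IsFold π a b v v' V := by
  have hf := IsLabelled.triple ha hb hv
  let B := liftMap π wordAvoid ![a, b, v]
  let B' := liftInv π wordAvoid avoidFourInv ![a, b, v]
  have hB : ∀ y, π (B y) = avoidFour (π y) := label_liftMap hf actWord_wordAvoid
  have hB'B : ∀ y, B' (B y) = y := liftInv_liftMap hf actWord_wordAvoid avoidFourInv_avoidFour
  have hBB' : ∀ y, π y % 4 ≠ 0 → B (B' y) = y := fun y hy =>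
    liftMap_liftInv hf actWord_wordAvoid (avoidFour_avoidFourInv hy)
  -- The part of the folded involution over the labels not divisible by `4`.
  let E : Y → Y := fun y => if π y % 4 = 0 then y else B (v' (B' y))
  have hEmod : ∀ y, π y % 4 ≠ 0 → π (B (v' (B' y))) = tailMove (π y) := fun y hy => by
    rw [hB, hv'.label, avoidFour_twinMove, ← hB, hBB' y hy]
  have hE : IsLabelled π E tailMove := by
    refine ⟨fun y => ?_, fun y => ?_⟩ <;> by_cases h : π y % 4 = 0
    · simp [E, h]
    · have h' : π (B (v' (B' y))) % 4 ≠ 0 := by rwa [hEmod y h, tailMove_mod]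
      simp only [E, if_neg h, if_neg h']
      rw [hB'B, hv'.invol, hBB' y h]
    · simp [E, h, tailMove]
    · simp only [E, if_neg h, hEmod y h]
  have hg := IsLabelled.triple ha hb hE
  let G := liftMap π wordFour ![a, b, E]
  let G' := liftInv π wordFour (· / 4) ![a, b, E]
  have hG : ∀ y, π (G y) = 4 * π y := label_liftMap hg actWord_wordFour
  have hG'G : ∀ y, G' (G y) = y := liftInv_liftMap hg actWord_wordFour (by simp)
  have hGG' : ∀ y, π y % 4 = 0 → G (G' y) = y := fun y hy =>
    liftMap_liftInv hg actWord_wordFour (four_mul_div_label hy)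
  have hG' : ∀ y, π y % 4 = 0 → π (G' y) = π y / 4 := fun y hy =>
    label_liftInv hg actWord_wordFour (four_mul_div_label hy)
  let V : Y → Y := fun y => if π y % 4 = 0 then G (v (G' y)) else E y
  have hVE : outerPart π V = E := by
    funext y
    by_cases h : π y % 4 = 0 <;> simp [outerPart, V, E, h]
  refine ⟨V, ⟨fun y => ?_, fun y => ?_⟩, ⟨fun y => ?_, fun y => ?_⟩⟩
  · by_cases h : π y % 4 = 0
    · have h' : π (G (v (G' y))) % 4 = 0 := by rw [hG]; omega
      simp only [V, if_pos h, if_pos h']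
      rw [hG'G, hv.invol, hGG' y h]
    · have h' : π (E y) % 4 ≠ 0 := by rwa [hE.label, tailMove_mod]
      simp only [V, if_neg h, if_neg h', hE.invol]
  · by_cases h : π y % 4 = 0
    · simp only [V, if_pos h]
      rw [hG, hv.label, hG' y h, foldedMove_of_mod_eq_zero h]
    · simp only [V, if_neg h]
      rw [hE.label, foldedMove_of_mod_ne_zero h]
  · rw [hVE]
    change V (G y) = G (v y)
    have h : π (G y) % 4 = 0 := by rw [hG]; omega
    simp only [V, if_pos h, hG'G]
  · change V (B y) = B (v' y)
    have h : π (B y) % 4 ≠ 0 := by rw [hB]; exact avoidFour_mod_ne_zero _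
    simp only [V, E, if_neg h, hB'B]

/-- Every involution over `foldedMove` is obtained by folding: conjugating it back along the lift of
`n ↦ 4 * n`, which only depends on `a`, `b` and the part over the labels not divisible by `4`, gives
`v`, and then conjugating it back along the lift of `avoidFour` gives `v'`. -/
theorem exists_isFold_of_folded (ha : IsLabelled π a flipBit) (hb : IsLabelled π b swapMid)
    (hV : IsLabelled π V foldedMove) :
    ∃ v v', IsLabelled π v tailMove ∧ IsLabelled π v' twinMove ∧ IsFold π a b v v' V := by
  have hg := IsLabelled.triple ha hb (outerPart_isLabelled hV)
  let G := liftMap π wordFour ![a, b, outerPart π V]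
  let G' := liftInv π wordFour (· / 4) ![a, b, outerPart π V]
  have hG : ∀ y, π (G y) = 4 * π y := label_liftMap hg actWord_wordFour
  have hG'G : ∀ y, G' (G y) = y := liftInv_liftMap hg actWord_wordFour (by simp)
  have hVG : ∀ y, π (V (G y)) = 4 * tailMove (π y) := fun y => by
    rw [hV.label, hG, foldedMove_of_mod_eq_zero (by omega), Nat.mul_div_cancel_left _ (by omega)]
  have hGG' : ∀ y, G (G' (V (G y))) = V (G y) := fun y =>
    liftMap_liftInv hg actWord_wordFour (four_mul_div_label (by rw [hVG]; omega))
  let v : Y → Y := fun y => G' (V (G y))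
  have hv : IsLabelled π v tailMove := by
    refine ⟨fun y => ?_, fun y => ?_⟩
    · simp only [v, hGG', hV.invol, hG'G]
    · have h := hG (v y)
      rw [hGG', hVG] at h
      omega
  have hf := IsLabelled.triple ha hb hv
  let B := liftMap π wordAvoid ![a, b, v]
  let B' := liftInv π wordAvoid avoidFourInv ![a, b, v]
  have hB : ∀ y, π (B y) = avoidFour (π y) := label_liftMap hf actWord_wordAvoid
  have hB'B : ∀ y, B' (B y) = y := liftInv_liftMap hf actWord_wordAvoid avoidFourInv_avoidFour
  have hVB : ∀ y, π (V (B y)) = avoidFour (twinMove (π y)) := fun y => by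
    rw [hV.label, hB, foldedMove_of_mod_ne_zero (avoidFour_mod_ne_zero _), avoidFour_twinMove]
  have hBB' : ∀ y, B (B' (V (B y))) = V (B y) := fun y =>
    liftMap_liftInv hf actWord_wordAvoid
      (avoidFour_avoidFourInv (by rw [hVB]; exact avoidFour_mod_ne_zero _))
  refine ⟨v, fun y => B' (V (B y)), hv, ⟨fun y => ?_, fun y => ?_⟩, ⟨fun y => ?_, fun y => ?_⟩⟩
  · simp only [hBB', hV.invol, hB'B]
  · have h := hB (B' (V (B y)))
    rw [hBB', hVB] at h
    rw [← avoidFourInv_avoidFour (π (B' (V (B y)))), ← h, avoidFourInv_avoidFour]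
  · exact (hGG' y).symm
  · exact (hBB' y).symm

section Naturality

variable {ρ : Z → ℕ} {a₁ b₁ v₁ v₁' V₁ : Z → Z} {F : Y → Z}

theorem map_triple {e : Y → Y} {e₁ : Z → Z} (hFa : ∀ y, F (a y) = a₁ (F y))
    (hFb : ∀ y, F (b y) = b₁ (F y)) (hFe : ∀ y, F (e y) = e₁ (F y)) (l : Fin 3) (y : Y) :
    F (![a, b, e] l y) = ![a₁, b₁, e₁] l (F y) := by
  fin_cases l
  exacts [hFa y, hFb y, hFe y]

/-- A map of labelled sets that commutes with the unfolded involutions commutes with the folded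
one. -/
theorem IsFold.map_folded (ha : IsLabelled π a flipBit) (hb : IsLabelled π b swapMid)
    (hv : IsLabelled π v tailMove) (hV : IsLabelled π V foldedMove)
    (h : IsFold π a b v v' V) (h₁ : IsFold ρ a₁ b₁ v₁ v₁' V₁)
    (hF : ∀ y, ρ (F y) = π y) (hFa : ∀ y, F (a y) = a₁ (F y)) (hFb : ∀ y, F (b y) = b₁ (F y))
    (hFv : ∀ y, F (v y) = v₁ (F y)) (hFv' : ∀ y, F (v' y) = v₁' (F y)) (y : Y) :
    F (V y) = V₁ (F y) := by
  have hFB := map_liftMap (W := wordAvoid) hF (map_triple hFa hFb hFv)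
  have outer : ∀ y, π y % 4 ≠ 0 → F (V y) = V₁ (F y) := fun y hy => by
    have hy' := liftMap_liftInv (IsLabelled.triple ha hb hv) actWord_wordAvoid
      (avoidFour_avoidFourInv hy)
    rw [← hy', h.avoid, hFB, hFB, h₁.avoid, hFv']
  have hFE : ∀ y, F (outerPart π V y) = outerPart ρ V₁ (F y) := fun y => by
    unfold outerPart
    rw [hF]
    split_ifs with hy
    exacts [rfl, outer y hy]
  have hFG := map_liftMap (W := wordFour) hF (map_triple hFa hFb hFE)
  by_cases hy : π y % 4 = 0
  · have hy' := liftMap_liftInv (m' := (· / 4))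
      (IsLabelled.triple ha hb (outerPart_isLabelled hV)) actWord_wordFour
      (four_mul_div_label hy)
    rw [← hy', h.four, hFG, hFG, h₁.four, hFv]
  · exact outer y hy

/-- A map of labelled sets that commutes with the folded involution commutes with the unfolded
ones. -/
theorem IsFold.map_unfolded (ha : IsLabelled ρ a₁ flipBit) (hb : IsLabelled ρ b₁ swapMid)
    (hv : IsLabelled ρ v₁ tailMove) (hV : IsLabelled ρ V₁ foldedMove)
    (h : IsFold π a b v v' V) (h₁ : IsFold ρ a₁ b₁ v₁ v₁' V₁)
    (hF : ∀ y, ρ (F y) = π y) (hFa : ∀ y, F (a y) = a₁ (F y)) (hFb : ∀ y, F (b y) = b₁ (F y))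
    (hFV : ∀ y, F (V y) = V₁ (F y)) :
    (∀ y, F (v y) = v₁ (F y)) ∧ ∀ y, F (v' y) = v₁' (F y) := by
  have hFE : ∀ y, F (outerPart π V y) = outerPart ρ V₁ (F y) := fun y => by
    unfold outerPart
    rw [hF]
    split_ifs
    exacts [rfl, hFV y]
  have hFG := map_liftMap (W := wordFour) hF (map_triple hFa hFb hFE)
  have hFv : ∀ y, F (v y) = v₁ (F y) := fun y => by
    have hinj := (Function.LeftInverse.injective
      (liftInv_liftMap (m' := (· / 4)) (IsLabelled.triple ha hb (outerPart_isLabelled hV))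
        actWord_wordFour (by simp)))
    apply hinj
    rw [← hFG, ← h.four, hFV, hFG, h₁.four]
  refine ⟨hFv, fun y => ?_⟩
  have hFB := map_liftMap (W := wordAvoid) hF (map_triple hFa hFb hFv)
  have hinj := (Function.LeftInverse.injective
    (liftInv_liftMap (IsLabelled.triple ha hb hv) actWord_wordAvoid avoidFourInv_avoidFour))
  apply hinj
  rw [← hFB, ← h.avoid, hFV, hFB, h₁.avoid]

end Naturality

section Distance

variable {d : Y → Y → ℕ}

/-- An upper bound for the displacement of folded and unfolded involutions. The words for the two
lifts have length at most `56`; the first lift conjugates a displacement of `1`, and its result,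
bounded by `2 * 56 + 1`, is the displacement of a letter in the words of the second lift. -/
def foldBound : ℕ := 2 * (56 * (2 * 56 + 1)) + 1

theorem dist_conj_le (hsymm : ∀ x y, d x y = d y x) (htri : ∀ x y z, d x z ≤ d x y + d y z)
    {G : Y → Y} {K : ℕ} (hG : ∀ y, d y (G y) ≤ K) (x y : Y) :
    d x y ≤ 2 * K + d (G x) (G y) ∧ d (G x) (G y) ≤ 2 * K + d x y := by
  have h1 := htri x (G x) y
  have h2 := htri (G x) (G y) y
  have h3 := htri (G x) x (G y)
  have h4 := htri x y (G y)
  have h5 := hsymm (G x) x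
  have h6 := hsymm (G y) y
  have h7 := hG x
  have h8 := hG y
  omega

theorem IsFold.dist_folded_le (hd : ∀ y, d y y = 0) (hsymm : ∀ x y, d x y = d y x)
    (htri : ∀ x y z, d x z ≤ d x y + d y z)
    (ha : IsLabelled π a flipBit) (hb : IsLabelled π b swapMid)
    (hv : IsLabelled π v tailMove) (hV : IsLabelled π V foldedMove) (h : IsFold π a b v v' V)
    (hda : ∀ y, d y (a y) ≤ 1) (hdb : ∀ y, d y (b y) ≤ 1) (hdv : ∀ y, d y (v y) ≤ 1)
    (hdv' : ∀ y, d y (v' y) ≤ 1) (y : Y) : d y (V y) ≤ foldBound := by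
  have hB := dist_liftMap_le (π := π) (W := wordAvoid) hd htri
    (forall_triple (P := fun f => ∀ y, d y (f y) ≤ 1) hda hdb hdv) length_wordAvoid
  have outer : ∀ y, π y % 4 ≠ 0 → d y (V y) ≤ 2 * 56 + 1 := fun y hy => by
    have hy' := liftMap_liftInv (IsLabelled.triple ha hb hv) actWord_wordAvoid
      (avoidFour_avoidFourInv hy)
    rw [← hy', h.avoid]
    exact (dist_conj_le hsymm htri hB _ _).2.trans (Nat.add_le_add_left (hdv' _) _)
  have hE : ∀ y, d y (outerPart π V y) ≤ 2 * 56 + 1 := fun y => by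
    unfold outerPart
    split_ifs with hy
    exacts [by simp [hd], outer y hy]
  have hG := dist_liftMap_le (π := π) (W := wordFour) hd htri
    (forall_triple (P := fun f => ∀ y, d y (f y) ≤ 2 * 56 + 1) (fun y => (hda y).trans (by omega))
      (fun y => (hdb y).trans (by omega)) hE) length_wordFour
  by_cases hy : π y % 4 = 0
  · have hy' := liftMap_liftInv (m' := (· / 4))
      (IsLabelled.triple ha hb (outerPart_isLabelled hV)) actWord_wordFour
      (four_mul_div_label hy)
    rw [← hy', h.four]
    exact (dist_conj_le hsymm htri hG _ _).2.trans (Nat.add_le_add_left (hdv _) _)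
  · exact (outer y hy).trans (by simp [foldBound])

theorem IsFold.dist_unfolded_le (hd : ∀ y, d y y = 0) (hsymm : ∀ x y, d x y = d y x)
    (htri : ∀ x y z, d x z ≤ d x y + d y z) (h : IsFold π a b v v' V)
    (hda : ∀ y, d y (a y) ≤ 1) (hdb : ∀ y, d y (b y) ≤ 1) (hdV : ∀ y, d y (V y) ≤ 1) (y : Y) :
    d y (v y) ≤ foldBound ∧ d y (v' y) ≤ foldBound := by
  have hE : ∀ y, d y (outerPart π V y) ≤ 1 := fun y => by
    unfold outerPart
    split_ifs
    exacts [by simp [hd], hdV y]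
  have hG := dist_liftMap_le (π := π) (W := wordFour) hd htri
    (forall_triple (P := fun f => ∀ y, d y (f y) ≤ 1) hda hdb hE) length_wordFour
  have hv : ∀ y, d y (v y) ≤ 2 * 56 + 1 := fun y => by
    have h1 := (dist_conj_le hsymm htri hG y (v y)).1
    rw [← h.four] at h1
    exact h1.trans (Nat.add_le_add_left (hdV _) _)
  have hB := dist_liftMap_le (π := π) (W := wordAvoid) hd htri
    (forall_triple (P := fun f => ∀ y, d y (f y) ≤ 2 * 56 + 1) (fun y => (hda y).trans (by omega))
      (fun y => (hdb y).trans (by omega)) hv) length_wordAvoid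
  refine ⟨(hv y).trans (by simp [foldBound]), ?_⟩
  have h1 := (dist_conj_le hsymm htri hB y (v' y)).1
  rw [← h.avoid] at h1
  exact h1.trans (Nat.add_le_add_left (hdV _) _)

end Distance

end Fold

/-! ### Right-angled Coxeter groups -/

section RACG

variable {V : Type*} {Γ : SimpleGraph V}

theorem racgGen_mul_self (s : V) : racgGen Γ s * racgGen Γ s = 1 :=
  (racgMatrix Γ).toCoxeterSystem.simple_mul_simple_self s

theorem mul_racgGen_mul_racgGen (g : RACG Γ) (s : V) : g * racgGen Γ s * racgGen Γ s = g := by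
  rw [mul_assoc, racgGen_mul_self, mul_one]

theorem mul_racgGen_comm {s t : V} (h : Γ.Adj s t) (g : RACG Γ) :
    g * racgGen Γ s * racgGen Γ t = g * racgGen Γ t * racgGen Γ s := by
  have h1 := (racgMatrix Γ).toCoxeterSystem.simple_mul_simple_pow s t
  have h2 : (racgMatrix Γ) s t = 2 := by
    simp [racgMatrix, h, h.ne]
  rw [h2, pow_two] at h1
  change racgGen Γ s * racgGen Γ t * (racgGen Γ s * racgGen Γ t) = 1 at h1
  rw [mul_assoc, mul_assoc]
  congr 1
  have h3 := eq_inv_of_mul_eq_one_left h1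
  rw [mul_inv_rev, inv_eq_of_mul_eq_one_left (racgGen_mul_self s),
    inv_eq_of_mul_eq_one_left (racgGen_mul_self t)] at h3
  exact h3

theorem racg_induction {p : RACG Γ → Prop} (one : p 1) (mul : ∀ g s, p g → p (g * racgGen Γ s))
    (g : RACG Γ) : p g :=
  (racgMatrix Γ).toCoxeterSystem.simple_induction_right g one mul

theorem racg_isLiftable {M : Type*} [Monoid M] {f : V → M} (hf : ∀ s, f s * f s = 1)
    (hcomm : ∀ s t, Γ.Adj s t → f s * f t = f t * f s) : (racgMatrix Γ).IsLiftable f := by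
  intro s t
  by_cases hst : s = t
  · simp [racgMatrix, hst, hf]
  · by_cases h : Γ.Adj s t
    · simp only [racgMatrix, Matrix.of_apply, if_neg hst, if_pos h, pow_two]
      rw [mul_assoc, hcomm s t h, ← mul_assoc (f t), hf, one_mul, hf]
    · simp [racgMatrix, hst, h]

/-- Involutions of a set that commute along the edges of `Γ` define a right action of `W_Γ`; the
resulting map is the orbit map of `y₀`. -/
theorem exists_racg_orbitMap {Y : Type*} (f : V → Y → Y) (hf : ∀ s y, f s (f s y) = y)
    (hcomm : ∀ s t, Γ.Adj s t → ∀ y, f s (f t y) = f t (f s y)) (y₀ : Y) :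
    ∃ F : RACG Γ → Y, F 1 = y₀ ∧ ∀ g s, F (g * racgGen Γ s) = f s (F g) := by
  let p : V → Equiv.Perm Y := fun s => ⟨f s, f s, hf s, hf s⟩
  have hp : (racgMatrix Γ).IsLiftable p :=
    racg_isLiftable (fun s => Equiv.ext (hf s)) fun s t h => Equiv.ext (hcomm s t h)
  let Φ := (racgMatrix Γ).toCoxeterSystem.lift ⟨p, hp⟩
  have hΦ : ∀ s, Φ (racgGen Γ s) = p s := fun s =>
    (racgMatrix Γ).toCoxeterSystem.lift_apply_simple hp s
  refine ⟨fun g => Φ g⁻¹ y₀, by simp, fun g s => ?_⟩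
  change Φ (g * racgGen Γ s)⁻¹ y₀ = p s (Φ g⁻¹ y₀)
  rw [mul_inv_rev, inv_eq_of_mul_eq_one_left (racgGen_mul_self s), map_mul, hΦ]
  rfl

theorem racg_orbitMap_unique {Y : Type*} {f : V → Y → Y} {F F' : RACG Γ → Y} (h1 : F 1 = F' 1)
    (hF : ∀ g s, F (g * racgGen Γ s) = f s (F g))
    (hF' : ∀ g s, F' (g * racgGen Γ s) = f s (F' g)) (g : RACG Γ) : F g = F' g := by
  induction g using racg_induction with
  | one => exact h1
  | mul g s ih => rw [hF, hF', ih]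

theorem davisSkeleton_connected : (davisSkeleton Γ).Connected := by
  have key : ∀ g x : RACG Γ, (davisSkeleton Γ).Reachable x (x * g) := by
    intro g x
    induction g using racg_induction with
    | one => rw [mul_one]
    | mul g s ih =>
      refine ih.trans ?_
      by_cases h : x * g = x * (g * racgGen Γ s)
      · rw [← h]
      · refine SimpleGraph.Adj.reachable ?_
        rw [davisSkeleton, SimpleGraph.mulCayley_adj']
        exact ⟨h, _, ⟨s, rfl⟩, Or.inl (mul_assoc ..)⟩
  exact ⟨fun x y => by simpa using key (x⁻¹ * y) x⟩

theorem dist_mul_racgGen_le (g : RACG Γ) (s : V) :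
    (davisSkeleton Γ).dist g (g * racgGen Γ s) ≤ 1 := by
  by_cases h : g = g * racgGen Γ s
  · rw [← h, SimpleGraph.dist_self]
    omega
  · refine (SimpleGraph.dist_eq_one_iff_adj.2 ?_).le
    rw [davisSkeleton, SimpleGraph.mulCayley_adj']
    exact ⟨h, _, ⟨s, rfl⟩, Or.inl rfl⟩

/-- A map that moves the ends of every edge of the Davis complex at most `K` apart is `K`-Lipschitz.
-/
theorem dist_map_le {X : Type*} {H : SimpleGraph X} (hH : H.Connected) {F : RACG Γ → X} {K : ℕ}
    (hF : ∀ g s, H.dist (F g) (F (g * racgGen Γ s)) ≤ K) (x y : RACG Γ) :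
    H.dist (F x) (F y) ≤ K * (davisSkeleton Γ).dist x y := by
  obtain ⟨p, hp⟩ := davisSkeleton_connected.exists_walk_length_eq_dist x y
  rw [← hp]
  clear hp
  induction p with
  | nil => simp
  | @cons x z y hxz p ih =>
    have h1 : H.dist (F x) (F z) ≤ K := by
      rw [davisSkeleton, SimpleGraph.mulCayley_adj'] at hxz
      obtain ⟨-, g, ⟨s, rfl⟩, rfl | rfl⟩ := hxz
      · exact hF x s
      · rw [SimpleGraph.dist_comm]
        exact hF z s
    have h2 := hH.dist_triangle (u := F x) (v := F z) (w := F y)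
    rw [SimpleGraph.Walk.length_cons, mul_add, mul_one]
    omega

/-- A bijection of right-angled Coxeter groups that is, like its inverse, Lipschitz for the word
metrics is a quasiisometry. -/
theorem isQuasiIsometry_of_inverse {V' : Type*} {Γ' : SimpleGraph V'} {φ : RACG Γ → RACG Γ'}
    {ψ : RACG Γ' → RACG Γ} {K : ℕ} (hψφ : ∀ g, ψ (φ g) = g) (hφψ : ∀ g, φ (ψ g) = g)
    (hφ : ∀ g s, (davisSkeleton Γ').dist (φ g) (φ (g * racgGen Γ s)) ≤ K)
    (hψ : ∀ g s, (davisSkeleton Γ).dist (ψ g) (ψ (g * racgGen Γ' s)) ≤ K) :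
    IsQuasiIsometry (davisSkeleton Γ) (davisSkeleton Γ') φ := by
  refine ⟨K + 1, 0, by simp, le_rfl, fun x y => ⟨?_, ?_⟩, fun y => ⟨ψ y, by simp [hφψ]⟩⟩
  · have h := dist_map_le davisSkeleton_connected hψ (φ x) (φ y)
    rw [hψφ, hψφ] at h
    have h' : ((davisSkeleton Γ).dist x y : ℝ) ≤ K * (davisSkeleton Γ').dist (φ x) (φ y) := by
      exact_mod_cast h
    have h0 : (0 : ℝ) ≤ (davisSkeleton Γ').dist (φ x) (φ y) := Nat.cast_nonneg _
    rw [sub_zero, one_div, inv_mul_le_iff₀ (by positivity)]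
    linarith
  · have h := dist_map_le davisSkeleton_connected hφ x y
    have h' : ((davisSkeleton Γ').dist (φ x) (φ y) : ℝ) ≤ K * (davisSkeleton Γ).dist x y := by
      exact_mod_cast h
    have h0 : (0 : ℝ) ≤ (davisSkeleton Γ).dist x y := Nat.cast_nonneg _
    linarith

/-- If `φ` is injective and commutes with right multiplication by the generators in `A`, then on
`g Σ_A` it is a translation followed by the homomorphism `j`, hence a colour-preserving
isomorphism. -/
theorem isColorPreservingIso_of_map_mul {V' : Type*} {Γ' : SimpleGraph V'} {κ : V → V'}
    (hκi : Function.Injective κ)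
    (hκ : ∀ x y, Γ'.Adj (κ x) (κ y) ↔ Γ.Adj x y) {j : RACG Γ →* RACG Γ'}
    (hj : ∀ s, j (racgGen Γ s) = racgGen Γ' (κ s)) {A : Set V} {φ : RACG Γ → RACG Γ'}
    (hinj : Function.Injective φ)
    (hφ : ∀ g, ∀ s ∈ A, φ (g * racgGen Γ s) = φ g * racgGen Γ' (κ s)) (g : RACG Γ) :
    IsColorPreservingIso κ A φ g (φ g) := by
  have hspec : ∀ T : Set V, (specialSubgroup Γ T).map j = specialSubgroup Γ' (κ '' T) := by
    intro T
    rw [specialSubgroup, MonoidHom.map_closure, specialSubgroup, Set.image_image, Set.image_image]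
    simp only [hj]
  have hmul : ∀ w ∈ specialSubgroup Γ A, ∀ g, φ (g * w) = φ g * j w := by
    intro w hw
    induction hw using Subgroup.closure_induction with
    | mem x hx =>
      obtain ⟨s, hs, rfl⟩ := hx
      intro g
      rw [hφ g s hs, hj]
    | one => simp
    | mul x y _ _ hx hy =>
      intro g
      rw [← mul_assoc, hy, hx, map_mul, mul_assoc]
    | inv x _ hx =>
      intro g
      have h := hx (g * x⁻¹)
      rw [inv_mul_cancel_right] at h
      rw [h, map_inv, mul_inv_cancel_right]
  have himage : ∀ T ⊆ A, ∀ x, φ '' (x • (specialSubgroup Γ T : Set (RACG Γ))) =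
      φ x • (specialSubgroup Γ' (κ '' T) : Set (RACG Γ')) := by
    intro T hT x
    have hle : specialSubgroup Γ T ≤ specialSubgroup Γ A :=
      Subgroup.closure_mono (Set.image_mono hT)
    rw [← hspec T, Subgroup.coe_map, ← Set.image_smul, ← Set.image_smul, Set.image_image,
      Set.image_image]
    exact Set.image_congr fun w hw => hmul w (hle hw) x
  have hvert : φ '' standardVertices Γ A g = standardVertices Γ' (κ '' A) (φ g) :=
    himage A subset_rfl g
  refine ⟨⟨?_, hinj.injOn, ?_⟩, fun x _ y _ s hs => ?_, fun c _ => ⟨?_, ?_⟩⟩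
  · rw [← hvert]
    exact Set.mapsTo_image ..
  · rw [← hvert]
    exact Set.surjOn_image ..
  · rw [IsDavisEdge, IsDavisEdge, ← hφ x s hs, hinj.eq_iff]
  · rintro ⟨x, hx, T, hT, hclique, rfl⟩
    refine ⟨φ x, hvert ▸ Set.mem_image_of_mem φ hx, κ '' T, Set.image_mono hT, ?_, himage T hT x⟩
    rintro _ ⟨s, hs, rfl⟩ _ ⟨t, ht, rfl⟩ hst
    exact (hκ s t).2 (hclique hs ht fun h => hst (h ▸ rfl))
  · rintro ⟨x', hx', T', hT', hclique, hc⟩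
    obtain ⟨T, hT, rfl⟩ := Set.subset_image_iff.1 hT'
    rw [← hvert] at hx'
    obtain ⟨x, hx, rfl⟩ := hx'
    rw [← himage T hT x] at hc
    refine ⟨x, hx, T, hT, ?_, hinj.image_injective hc⟩
    intro s hs t ht hst
    exact (hκ s t).1 (hclique (Set.mem_image_of_mem κ hs) (Set.mem_image_of_mem κ ht)
      (hκi.ne hst))

end RACG

/-! ### Cloning a vertex -/

section Clone

variable {V : Type*} {Γ : SimpleGraph V}

/-- Two vertices of which `v` is a satellite are not adjacent: a common neighbour, which exists
because `v` is not isolated, would complete a triangle. -/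
theorem IsSatellite.not_adj_of_cliqueFree (hconn : Γ.Connected) (htri : Γ.CliqueFree 3)
    {v w₁ w₂ : V} (h₁ : IsSatellite Γ v w₁) (h₂ : IsSatellite Γ v w₂) : ¬ Γ.Adj w₁ w₂ := by
  classical
  intro h
  have : Nontrivial V := ⟨⟨v, w₁, h₁.1⟩⟩
  obtain ⟨u, hu⟩ := hconn.preconnected.exists_adj_of_nontrivial v
  have hu₁ : Γ.Adj w₁ u := h₁.2 hu
  have hu₂ : Γ.Adj w₂ u := h₂.2 hu
  exact htri {w₁, w₂, u} (SimpleGraph.is3Clique_triple_iff.2 ⟨h, hu₁, hu₂⟩)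

theorem IsSatellite.not_adj {v w : V} (h : IsSatellite Γ v w) : ¬ Γ.Adj v w := fun h' =>
  Γ.loopless.irrefl w (h.2 h')

/-- The homomorphism `W_Γ → W_Γ'` induced by the inclusion of `Γ` into the graph `Γ'` obtained by
cloning `v`. -/
theorem exists_hom_cloneGraph (v : V) :
    ∃ j : RACG Γ →* RACG (cloneGraph Γ v),
      ∀ s, j (racgGen Γ s) = racgGen (cloneGraph Γ v) (some s) := by
  have hl : (racgMatrix Γ).IsLiftable fun s => racgGen (cloneGraph Γ v) (some s) :=
    racg_isLiftable (fun s => racgGen_mul_self _) fun s t h => by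
      simpa using mul_racgGen_comm (Γ := cloneGraph Γ v) (s := some s) (t := some t) h 1
  exact ⟨(racgMatrix Γ).toCoxeterSystem.lift ⟨_, hl⟩,
    fun s => (racgMatrix Γ).toCoxeterSystem.lift_apply_simple hl s⟩

open scoped Classical in
/-- The action on labels of the generators of `W_Γ`. -/
noncomputable def labelMove (w₁ w₂ v : V) (s : V) : ℕ → ℕ :=
  if s = w₁ then flipBit else if s = w₂ then swapMid else if s = v then foldedMove else id

open scoped Classical in
/-- The action on labels of the generators of the right-angled Coxeter group of the graph obtained
from `Γ` by cloning `v`. -/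
noncomputable def labelMoveClone (w₁ w₂ v : V) : Option V → ℕ → ℕ
  | none => twinMove
  | some s =>
    if s = w₁ then flipBit else if s = w₂ then swapMid else if s = v then tailMove else id

theorem labelMove_invol (w₁ w₂ v s : V) (n : ℕ) :
    labelMove w₁ w₂ v s (labelMove w₁ w₂ v s n) = n := by
  unfold labelMove
  split_ifs
  exacts [flipBit_flipBit n, swapMid_swapMid n, foldedMove_foldedMove n, rfl]

theorem labelMoveClone_invol (w₁ w₂ v : V) (s : Option V) (n : ℕ) :
    labelMoveClone w₁ w₂ v s (labelMoveClone w₁ w₂ v s n) = n := by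
  cases s with
  | none => exact twinMove_twinMove n
  | some s =>
    simp only [labelMoveClone]
    split_ifs
    exacts [flipBit_flipBit n, swapMid_swapMid n, tailMove_tailMove n, rfl]

theorem labelMove_of_ne {w₁ w₂ v s : V} (h₁ : s ≠ w₁) (h₂ : s ≠ w₂) (h : s ≠ v) :
    labelMove w₁ w₂ v s = id := by
  simp [labelMove, h₁, h₂, h]

theorem labelMoveClone_of_ne {w₁ w₂ v s : V} (h₁ : s ≠ w₁) (h₂ : s ≠ w₂) (h : s ≠ v) :
    labelMoveClone w₁ w₂ v (some s) = id := by
  simp [labelMoveClone, h₁, h₂, h]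

/-- Right multiplication by a generator. -/
noncomputable def rightMul (Γ : SimpleGraph V) (s : V) (g : RACG Γ) : RACG Γ := g * racgGen Γ s

theorem rightMul_rightMul (s : V) (g : RACG Γ) : rightMul Γ s (rightMul Γ s g) = g :=
  mul_racgGen_mul_racgGen g s

theorem rightMul_comm {s t : V} (h : Γ.Adj s t) (g : RACG Γ) :
    rightMul Γ s (rightMul Γ t g) = rightMul Γ t (rightMul Γ s g) :=
  mul_racgGen_comm h.symm g

theorem isLabelled_rightMul {π : RACG Γ → ℕ} {m : V → ℕ → ℕ}
    (hπ : ∀ g s, π (g * racgGen Γ s) = m s (π g)) {s : V} {m' : ℕ → ℕ} (h : m s = m') :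
    IsLabelled π (rightMul Γ s) m' :=
  ⟨rightMul_rightMul s, fun g => by rw [rightMul, hπ, h]⟩

/-- The groups `W_Γ` and `W_Γ'`, where `Γ'` is obtained by cloning `v`, admit mutually inverse
Lipschitz bijections that commute with right multiplication by the generators other than `v`. -/
theorem exists_lipschitz_bijection {v w₁ w₂ : V} (hne : w₁ ≠ w₂) (h₁ : IsSatellite Γ v w₁)
    (h₂ : IsSatellite Γ v w₂) (hadj : ¬ Γ.Adj w₁ w₂) :
    ∃ (φ : RACG Γ → RACG (cloneGraph Γ v)) (ψ : RACG (cloneGraph Γ v) → RACG Γ),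
      (∀ g, ψ (φ g) = g) ∧ (∀ q, φ (ψ q) = q) ∧
      (∀ g s, s ≠ v → φ (g * racgGen Γ s) = φ g * racgGen (cloneGraph Γ v) (some s)) ∧
      (∀ g s, (davisSkeleton (cloneGraph Γ v)).dist (φ g) (φ (g * racgGen Γ s)) ≤ foldBound) ∧
      ∀ q s, (davisSkeleton Γ).dist (ψ q) (ψ (q * racgGen (cloneGraph Γ v) s)) ≤ foldBound := by
  classical
  set Γ' := cloneGraph Γ v
  have hv₁ := h₁.1
  have hv₂ := h₂.1
  have hn₁ := h₁.not_adj
  have hn₂ := h₂.not_adj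
  have hsome : ∀ {s t}, Γ.Adj s t → Γ'.Adj (some s) (some t) := fun h => h
  have hnone : ∀ {s}, Γ.Adj v s → Γ'.Adj none (some s) := fun h => h
  have hlink : ∀ {s}, Γ.Adj v s → s ≠ w₁ ∧ s ≠ w₂ ∧ s ≠ v := fun {s} h =>
    ⟨fun e => hn₁ (e ▸ h), fun e => hn₂ (e ▸ h), h.ne'⟩
  -- Both groups act on labels, since the generators that move labels are pairwise non-adjacent.
  obtain ⟨π, hπ1, hπ⟩ := exists_racg_orbitMap (Γ := Γ) (labelMove w₁ w₂ v)
    (labelMove_invol w₁ w₂ v) (by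
      intro s t hst n
      have hst' := hst.symm
      have hst'' := hst.ne
      unfold labelMove
      split_ifs <;> first | rfl | (subst_vars; simp_all [Γ.adj_comm])) 0
  obtain ⟨π', hπ1', hπ'⟩ := exists_racg_orbitMap (Γ := Γ') (labelMoveClone w₁ w₂ v)
    (labelMoveClone_invol w₁ w₂ v) (by
      rintro (_ | s) (_ | t) hst n
      · rfl
      · obtain ⟨ht₁, ht₂, ht⟩ := hlink hst
        rw [labelMoveClone_of_ne ht₁ ht₂ ht]
        rfl
      · obtain ⟨ht₁, ht₂, ht⟩ := hlink hst
        rw [labelMoveClone_of_ne ht₁ ht₂ ht]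
        rfl
      · change Γ.Adj s t at hst
        have hst' := hst.symm
        have hst'' := hst.ne
        simp only [labelMoveClone]
        split_ifs <;> first | rfl | (subst_vars; simp_all [Γ.adj_comm])) 0
  have ha : IsLabelled π (rightMul Γ w₁) flipBit := isLabelled_rightMul hπ (by simp [labelMove])
  have hb : IsLabelled π (rightMul Γ w₂) swapMid :=
    isLabelled_rightMul hπ (by simp [labelMove, hne.symm])
  have hV : IsLabelled π (rightMul Γ v) foldedMove :=
    isLabelled_rightMul hπ (by simp [labelMove, hv₁, hv₂])
  have ha' : IsLabelled π' (rightMul Γ' (some w₁)) flipBit :=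
    isLabelled_rightMul hπ' (by simp [labelMoveClone])
  have hb' : IsLabelled π' (rightMul Γ' (some w₂)) swapMid :=
    isLabelled_rightMul hπ' (by simp [labelMoveClone, hne.symm])
  have hv' : IsLabelled π' (rightMul Γ' (some v)) tailMove :=
    isLabelled_rightMul hπ' (by simp [labelMoveClone, hv₁, hv₂])
  have ht' : IsLabelled π' (rightMul Γ' none) twinMove := isLabelled_rightMul hπ' rfl
  obtain ⟨v₀, t₀, hv₀, ht₀, hfold⟩ := exists_isFold_of_folded ha hb hV
  obtain ⟨V₀, hV₀, hfold'⟩ := exists_isFold ha' hb' hv' ht'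
  -- By naturality the new involutions commute with the generators in the link of `v`.
  have hVlink : ∀ s, Γ.Adj v s → ∀ q,
      rightMul Γ' (some s) (V₀ q) = V₀ (rightMul Γ' (some s) q) := by
    intro s hs
    obtain ⟨hs₁, hs₂, hsv⟩ := hlink hs
    exact hfold'.map_folded ha' hb' hv' hV₀ hfold'
      (fun q => by rw [rightMul, hπ', labelMoveClone_of_ne hs₁ hs₂ hsv]; rfl)
      (rightMul_comm (hsome (h₁.2 hs).symm)) (rightMul_comm (hsome (h₂.2 hs).symm))
      (rightMul_comm (hsome hs.symm)) (rightMul_comm (hnone hs).symm)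
  have hvlink : ∀ s, Γ.Adj v s → (∀ g, rightMul Γ s (v₀ g) = v₀ (rightMul Γ s g)) ∧
      ∀ g, rightMul Γ s (t₀ g) = t₀ (rightMul Γ s g) := by
    intro s hs
    obtain ⟨hs₁, hs₂, hsv⟩ := hlink hs
    exact hfold.map_unfolded ha hb hv₀ hV hfold
      (fun q => by rw [rightMul, hπ, labelMove_of_ne hs₁ hs₂ hsv]; rfl)
      (rightMul_comm (h₁.2 hs).symm) (rightMul_comm (h₂.2 hs).symm) (rightMul_comm hs.symm)
  let f : V → RACG Γ' → RACG Γ' := fun s => if s = v then V₀ else rightMul Γ' (some s)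
  let f' : Option V → RACG Γ → RACG Γ
    | none => t₀
    | some s => if s = v then v₀ else rightMul Γ s
  have hfv : f v = V₀ := if_pos rfl
  have hfs : ∀ {s}, s ≠ v → f s = rightMul Γ' (some s) := fun h => if_neg h
  have hfv' : f' (some v) = v₀ := if_pos rfl
  have hfs' : ∀ {s}, s ≠ v → f' (some s) = rightMul Γ s := fun h => if_neg h
  obtain ⟨φ, hφ1, hφ⟩ := exists_racg_orbitMap (Γ := Γ) f (by
      intro s q
      by_cases hs : s = v
      · rw [hs, hfv, hV₀.invol]
      · rw [hfs hs, rightMul_rightMul]) (by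
      intro s t hst q
      by_cases hs : s = v
      · subst hs
        rw [hfv, hfs hst.ne', hVlink t hst]
      · by_cases ht : t = v
        · subst ht
          rw [hfv, hfs hs, hVlink s hst.symm]
        · rw [hfs hs, hfs ht, rightMul_comm (hsome hst)]) 1
  obtain ⟨ψ, hψ1, hψ⟩ := exists_racg_orbitMap (Γ := Γ') f' (by
      rintro (_ | s) q
      · exact ht₀.invol q
      · by_cases hs : s = v
        · rw [hs, hfv', hv₀.invol]
        · rw [hfs' hs, rightMul_rightMul]) (by
      rintro (_ | s) (_ | t) hst q
      · rfl
      · change Γ.Adj v t at hst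
        rw [hfs' hst.ne']
        exact ((hvlink t hst).2 q).symm
      · change Γ.Adj v s at hst
        rw [hfs' hst.ne']
        exact (hvlink s hst).2 q
      · change Γ.Adj s t at hst
        by_cases hs : s = v
        · subst hs
          rw [hfv', hfs' hst.ne', (hvlink t hst).1]
        · by_cases ht : t = v
          · subst ht
            rw [hfv', hfs' hs, (hvlink s hst.symm).1]
          · rw [hfs' hs, hfs' ht, rightMul_comm hst]) 1
  -- The orbit maps preserve labels.
  have hπφ : ∀ g, π' (φ g) = π g := by
    refine racg_orbitMap_unique (by rw [hφ1, hπ1, hπ1']) (fun g s => ?_) hπ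
    rw [hφ]
    by_cases hs : s = v
    · rw [hs, hfv, hV₀.label]
      simp [labelMove, hv₁, hv₂]
    · rw [hfs hs, rightMul, hπ']
      simp [labelMove, labelMoveClone, hs]
  have hπψ : ∀ q, π (ψ q) = π' q := by
    refine racg_orbitMap_unique (by rw [hψ1, hπ1, hπ1']) (fun q s => ?_) hπ'
    rw [hψ]
    rcases s with _ | s
    · exact ht₀.label _
    · by_cases hs : s = v
      · rw [hs, hfv', hv₀.label]
        simp [labelMoveClone, hv₁, hv₂]
      · rw [hfs' hs, rightMul, hπ]
        simp [labelMove, labelMoveClone, hs]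
  have hφs : ∀ {s}, s ≠ v → ∀ g, φ (rightMul Γ s g) = rightMul Γ' (some s) (φ g) :=
    fun hs g => by rw [rightMul, hφ, hfs hs]
  have hφv : ∀ g, φ (rightMul Γ v g) = V₀ (φ g) := fun g => by rw [rightMul, hφ, hfv]
  have hψs : ∀ {s}, s ≠ v → ∀ q, ψ (rightMul Γ' (some s) q) = rightMul Γ s (ψ q) :=
    fun hs q => by rw [rightMul, hψ, hfs' hs]
  have hψv : ∀ q, ψ (rightMul Γ' (some v) q) = v₀ (ψ q) := fun q => by
    rw [rightMul, hψ, hfv']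
  have hψt : ∀ q, ψ (rightMul Γ' none q) = t₀ (ψ q) := fun q => by rw [rightMul, hψ]
  -- By naturality each orbit map intertwines the involutions that it is not defined by.
  have hψV : ∀ q, ψ (V₀ q) = rightMul Γ v (ψ q) :=
    hfold'.map_folded ha' hb' hv' hV₀ hfold hπψ (hψs hv₁.symm) (hψs hv₂.symm) hψv hψt
  obtain ⟨hφv₀, hφt₀⟩ :=
    hfold.map_unfolded ha' hb' hv' hV₀ hfold' hπφ (hφs hv₁.symm) (hφs hv₂.symm) hφv
  have hdist := davisSkeleton_connected (Γ := Γ)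
  have hdist' := davisSkeleton_connected (Γ := Γ')
  refine ⟨φ, ψ, ?_, ?_, fun g s hs => hφs hs g, fun g s => ?_, fun q s => ?_⟩
  · refine racg_orbitMap_unique (f := rightMul Γ) (F' := id) (by simp [hφ1, hψ1])
      (fun g s => ?_) fun g s => rfl
    by_cases hs : s = v
    · rw [hs, ← hψV, ← hφv, rightMul]
    · rw [← hψs hs, ← hφs hs, rightMul]
  · refine racg_orbitMap_unique (f := rightMul Γ') (F' := id) (by simp [hφ1, hψ1])
      (fun q s => ?_) fun g s => rfl
    rcases s with _ | s
    · rw [← hφt₀, ← hψt, rightMul]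
    · by_cases hs : s = v
      · rw [hs, ← hφv₀, ← hψv, rightMul]
      · rw [← hφs hs, ← hψs hs, rightMul]
  · rw [hφ]
    by_cases hs : s = v
    · rw [hs, hfv]
      exact hfold'.dist_folded_le (fun _ => SimpleGraph.dist_self)
        (fun _ _ => SimpleGraph.dist_comm) (fun _ _ _ => hdist'.dist_triangle) ha' hb' hv' hV₀
        (fun q => dist_mul_racgGen_le q _) (fun q => dist_mul_racgGen_le q _)
        (fun q => dist_mul_racgGen_le q _) (fun q => dist_mul_racgGen_le q _) _
    · rw [hfs hs]
      exact (dist_mul_racgGen_le _ _).trans (by simp [foldBound])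
  · rw [hψ]
    have h := hfold.dist_unfolded_le (fun _ => SimpleGraph.dist_self)
      (fun _ _ => SimpleGraph.dist_comm) (fun _ _ _ => hdist.dist_triangle)
      (fun q => dist_mul_racgGen_le q _) (fun q => dist_mul_racgGen_le q _)
      (fun q => dist_mul_racgGen_le q _) (ψ q)
    rcases s with _ | s
    · exact h.2
    · by_cases hs : s = v
      · rw [hs, hfv']
        exact h.1
      · rw [hfs' hs]
        exact (dist_mul_racgGen_le _ _).trans (by simp [foldBound])

end Clone

theorem mainTheorem3 {V : Type*} [Finite V] (Γ : SimpleGraph V)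
    (hconn : Γ.Connected) (htri : Γ.CliqueFree 3) (v : V) (hv : IsClonable Γ v) :
    ∃ φ : RACG Γ → RACG (cloneGraph Γ v),
      IsQuasiIsometry (davisSkeleton Γ) (davisSkeleton (cloneGraph Γ v)) φ ∧
      ∀ g : RACG Γ, ∃ g' : RACG (cloneGraph Γ v),
        IsColorPreservingIso some {v}ᶜ φ g g' := by
  obtain ⟨w₁, w₂, hne, h₁, h₂⟩ := hv
  obtain ⟨φ, ψ, hψφ, hφψ, hφ, hdφ, hdψ⟩ := exists_lipschitz_bijection hne h₁ h₂
    (h₁.not_adj_of_cliqueFree hconn htri h₂)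
  obtain ⟨j, hj⟩ := exists_hom_cloneGraph (Γ := Γ) v
  exact ⟨φ, isQuasiIsometry_of_inverse hψφ hφψ hdφ hdψ, fun g => ⟨φ g,
    isColorPreservingIso_of_map_mul (Option.some_injective V) (fun _ _ => Iff.rfl) hj
      (Function.LeftInverse.injective hψφ) (fun g s hs => hφ g s hs) g⟩⟩
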